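/- Let $\mathbb{T}=\mathbb{R}/2\pi\mathbb{Z}$, $D_t=-i\,\partial/\partial t$ and $D_x=-i\,\partial/\partial x$ on $\mathbb{T}^2$ with coordinates $(t,x)$. A linear operator $L:\mathcal{D}'(\mathbb{T}^2)\to\mathcal{D}'(\mathbb{T}^2)$ is called globally hypoelliptic if $u\in\mathcal{D}'(\mathbb{T}^2)$ and $Lu\in C^\infty(\mathbb{T}^2)$ imply $u\in C^\infty(\mathbb{T}^2)$. A real number $\alpha$ is a Liouville number if for every $N\in\mathbb{N}$ there are integers $p$ and $q>1$ with $0<|\alpha-p/q|<q^{-N}$. Let $\omega=\alpha+i\beta$ with $\alpha,\beta\in\mathbb{R}$, let $\epsilon=\epsilon(t,x)\in C^\infty(\mathbb{T}^2)$ be complex-valued, and set $$L_\epsilon=D_t+\omega D_x+\epsilon(t,x),\qquad L_{\epsilon_0}=D_t+\omega D_x+\epsilon_0,\qquad \epsilon_0=\frac{1}{(2\pi)^2}\int_0^{2\pi}\!\!\int_0^{2\pi}\epsilon(t,x)\,dt\,dx .$$ (i) If $\beta\neq0$, then $L_\epsilon$ is globally hypoelliptic. (ii) If $\beta=0$ and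 $\alpha$ is irrational and not a Liouville number, then the following statements are equivalent: (a) $L_\epsilon$ is globally hypoelliptic; (b) $L_{\epsilon_0}$ is globally hypoelliptic; (c) there are constants $C>0$, $\theta>0$ and $\ell_0\in\mathbb{N}$, $\ell_0\ge1$, such that, for both choices of the sign, $$\inf_{\tau\in\mathbb{Z}}\bigl|\tau\pm\alpha\ell+\epsilon_0\bigr|\ \ge\ C\,\ell^{-\theta}\qquad\text{for all integers }\ell\ge\ell_0 .$$ -/

import Mathlib

/-! Smooth functions and distributions on the torus `𝕋² = (ℝ / 2πℤ)²`, with coordinates `(t, x)`. -/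

namespace Torus

section Functions

open scoped ContDiff

/-- The smooth complex functions on `𝕋²`, that is, the smooth functions `f (t, x)` on `ℝ²` that are
`2π`-periodic in `t` and in `x`. -/
def smoothSubalgebra : Subalgebra ℂ (ℝ × ℝ → ℂ) where
  carrier := {f | ContDiff ℝ ∞ f ∧
    (∀ t x, f (t + 2 * Real.pi, x) = f (t, x)) ∧ ∀ t x, f (t, x + 2 * Real.pi) = f (t, x)}
  mul_mem' := by
    rintro f g ⟨hf, hf1, hf2⟩ ⟨hg, hg1, hg2⟩
    exact ⟨hf.mul hg, fun t x => by simp [hf1, hg1], fun t x => by simp [hf2, hg2]⟩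
  add_mem' := by
    rintro f g ⟨hf, hf1, hf2⟩ ⟨hg, hg1, hg2⟩
    exact ⟨hf.add hg, fun t x => by simp [hf1, hg1], fun t x => by simp [hf2, hg2]⟩
  algebraMap_mem' := fun c => ⟨contDiff_const, fun _ _ => rfl, fun _ _ => rfl⟩

/-- `C^∞(𝕋²)`. It is a type of its own, so that it does not carry the topology of pointwise
convergence. -/
def Smooth : Type := smoothSubalgebra

noncomputable instance : CommRing Smooth := inferInstanceAs (CommRing smoothSubalgebra)

noncomputable instance : Algebra ℂ Smooth := inferInstanceAs (Algebra ℂ smoothSubalgebra)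

instance : CoeFun Smooth (fun _ => ℝ × ℝ → ℂ) := ⟨fun f => f.1⟩

theorem Smooth.contDiff (f : Smooth) : ContDiff ℝ ∞ f := f.2.1

theorem Smooth.ext {f g : Smooth} (h : ∀ p, f p = g p) : f = g := Subtype.ext (funext h)

theorem Smooth.add_apply (f g : Smooth) (p : ℝ × ℝ) : (f + g) p = f p + g p := rfl

theorem Smooth.mul_apply (f g : Smooth) (p : ℝ × ℝ) : (f * g) p = f p * g p := rfl

theorem Smooth.smul_apply (c : ℂ) (f : Smooth) (p : ℝ × ℝ) : (c • f) p = c * f p := rfl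

theorem Smooth.algebraMap_apply (c : ℂ) (p : ℝ × ℝ) : (algebraMap ℂ Smooth c) p = c := rfl

/-- `-i` times the derivative in the direction `v`, on `C^∞(𝕋²)`. -/
noncomputable def dirD (v : ℝ × ℝ) : Smooth →ₗ[ℂ] Smooth where
  toFun f := ⟨fun p => -Complex.I * fderiv ℝ f p v, by
    have hper : ∀ w : ℝ × ℝ, (∀ p, f (p + w) = f p) → ∀ p, fderiv ℝ f (p + w) = fderiv ℝ f p := by
      intro w hw p
      rw [← fderiv_comp_add_right w]
      exact congrArg (fun g => fderiv ℝ g p) (funext hw)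
    have h1 := hper (2 * Real.pi, 0) (fun p => by
      rw [show p + (2 * Real.pi, 0) = (p.1 + 2 * Real.pi, p.2) by ext <;> simp]
      exact f.2.2.1 p.1 p.2)
    have h2 := hper (0, 2 * Real.pi) (fun p => by
      rw [show p + (0, 2 * Real.pi) = (p.1, p.2 + 2 * Real.pi) by ext <;> simp]
      exact f.2.2.2 p.1 p.2)
    refine ⟨?_, fun t x => ?_, fun t x => ?_⟩
    · exact contDiff_const.mul
        ((f.contDiff.fderiv_right (m := ∞) (by simp)).clm_apply contDiff_const)
    · have := h1 (t, x)
      simp only [Prod.mk_add_mk, add_zero] at this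
      simp only [this]
    · have := h2 (t, x)
      simp only [Prod.mk_add_mk, add_zero] at this
      simp only [this]⟩
  map_add' f g := by
    refine Smooth.ext fun p => ?_
    have hf : DifferentiableAt ℝ f.1 p := f.contDiff.differentiable (by simp) p
    have hg : DifferentiableAt ℝ g.1 p := g.contDiff.differentiable (by simp) p
    change -Complex.I * fderiv ℝ (f.1 + g.1) p v
      = -Complex.I * fderiv ℝ f.1 p v + -Complex.I * fderiv ℝ g.1 p v
    rw [fderiv_add hf hg, add_apply]
    ring
  map_smul' c f := by
    refine Smooth.ext fun p => ?_
    have hf : DifferentiableAt ℝ f.1 p := f.contDiff.differentiable (by simp) p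
    change -Complex.I * fderiv ℝ (c • f.1) p v = c * (-Complex.I * fderiv ℝ f.1 p v)
    rw [fderiv_const_smul hf, smul_apply, smul_eq_mul]
    ring

theorem dirD_apply (v : ℝ × ℝ) (f : Smooth) (p : ℝ × ℝ) :
    dirD v f p = -Complex.I * fderiv ℝ f p v := rfl

/-- `D_t = -i ∂/∂t` on `C^∞(𝕋²)`. -/
noncomputable def Dt : Smooth →ₗ[ℂ] Smooth := dirD (1, 0)

/-- `D_x = -i ∂/∂x` on `C^∞(𝕋²)`. -/
noncomputable def Dx : Smooth →ₗ[ℂ] Smooth := dirD (0, 1)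

theorem dirD_comm (v w : ℝ × ℝ) (f : Smooth) : dirD v (dirD w f) = dirD w (dirD v f) := by
  refine Smooth.ext fun p => ?_
  have hd : DifferentiableAt ℝ (fderiv ℝ f.1) p :=
    (f.contDiff.fderiv_right (m := ∞) (by simp)).differentiable (by simp) p
  have key : ∀ a b : ℝ × ℝ,
      dirD a (dirD b f) p = -Complex.I * (-Complex.I * fderiv ℝ (fderiv ℝ f.1) p a b) := by
    intro a b
    change -Complex.I * fderiv ℝ (fun q => -Complex.I * fderiv ℝ f.1 q b) p a = _
    have h1 : HasFDerivAt (fun q => -Complex.I * fderiv ℝ f.1 q b)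
        (-Complex.I • ((fderiv ℝ (fderiv ℝ f.1) p).flip b)) p :=
      by
      have := (hd.hasFDerivAt.clm_apply (hasFDerivAt_const b p)).const_mul (-Complex.I)
      refine this.congr_fderiv ?_
      ext <;> simp
    rw [h1.fderiv]
    simp
  have hs : IsSymmSndFDerivAt ℝ f.1 p := f.contDiff.contDiffAt.isSymmSndFDerivAt (by
    rw [minSmoothness_of_isRCLikeNormedField]; exact WithTop.coe_le_coe.2 le_top)
  rw [key v w, key w v, hs v w]

theorem dirD_mul (v : ℝ × ℝ) (f g : Smooth) : dirD v (f * g) = dirD v f * g + f * dirD v g := by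
  refine Smooth.ext fun p => ?_
  have hf : DifferentiableAt ℝ f.1 p := f.contDiff.differentiable (by simp) p
  have hg : DifferentiableAt ℝ g.1 p := g.contDiff.differentiable (by simp) p
  change -Complex.I * fderiv ℝ (f.1 * g.1) p v
    = -Complex.I * fderiv ℝ f.1 p v * g.1 p + f.1 p * (-Complex.I * fderiv ℝ g.1 p v)
  rw [fderiv_mul hf hg]
  simp
  ring

theorem Smooth.bddAbove (f : Smooth) : BddAbove (Set.range fun p => ‖f p‖) := by
  have hpi : (0 : ℝ) < 2 * Real.pi := by positivity
  obtain ⟨B, hB⟩ := (isCompact_Icc (a := (0 : ℝ)) (b := 2 * Real.pi)).prod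
    (isCompact_Icc (a := (0 : ℝ)) (b := 2 * Real.pi)) |>.exists_bound_of_continuousOn
      f.contDiff.continuous.continuousOn
  refine ⟨B, ?_⟩
  rintro _ ⟨⟨t, x⟩, rfl⟩
  have h1 : ∀ y, Function.Periodic (fun s => f (s, y)) (2 * Real.pi) := fun y s => f.2.2.1 s y
  have h2 : ∀ s, Function.Periodic (fun y => f (s, y)) (2 * Real.pi) := fun s y => f.2.2.2 s y
  obtain ⟨t', ht', e1⟩ := (h1 x).exists_mem_Ico₀ hpi t
  obtain ⟨x', hx', e2⟩ := (h2 t').exists_mem_Ico₀ hpi x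
  have e : f (t, x) = f (t', x') := e1.trans e2
  change ‖f (t, x)‖ ≤ B
  rw [e]
  exact hB _ ⟨Set.Ico_subset_Icc_self ht', Set.Ico_subset_Icc_self hx'⟩

/-- The supremum norm on `C^∞(𝕋²)`. -/
noncomputable def supSeminorm : Seminorm ℂ Smooth :=
  Seminorm.of (fun f => ⨆ p, ‖f p‖)
    (fun f g => ciSup_le fun p => (norm_add_le _ _).trans
      (add_le_add (le_ciSup f.bddAbove p) (le_ciSup g.bddAbove p)))
    (fun c f => by
      simp only [Smooth.smul_apply, norm_mul]
      exact (Real.mul_iSup_of_nonneg (norm_nonneg c) _).symm)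

theorem supSeminorm_apply (f : Smooth) : supSeminorm f = ⨆ p, ‖f p‖ := rfl

/-- The seminorms `f ↦ sup |D_t^a D_x^b f|`, for `(a, b) ∈ ℕ²`. -/
noncomputable def seminorms : SeminormFamily ℂ Smooth (ℕ × ℕ) :=
  fun k => supSeminorm.comp ((Dt ^ k.1) * (Dx ^ k.2))

theorem seminorms_apply (k : ℕ × ℕ) (f : Smooth) :
    seminorms k f = ⨆ p, ‖((Dt ^ k.1) ((Dx ^ k.2) f)) p‖ := rfl

/-- The usual Fréchet topology of `C^∞(𝕋²)`. -/
noncomputable instance : TopologicalSpace Smooth := seminorms.moduleFilterBasis.topology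

theorem withSeminorms : WithSeminorms seminorms := ⟨rfl⟩

instance : IsTopologicalAddGroup Smooth := withSeminorms.topologicalAddGroup

theorem continuous_Dt : Continuous Dt := by
  refine withSeminorms.continuous_of_continuous_comp Dt fun k => ?_
  have : (seminorms k).comp Dt = seminorms (k.1 + 1, k.2) := by
    ext f
    have hc : Commute Dx Dt := LinearMap.ext fun f => dirD_comm _ _ f
    have : ((Dt ^ k.1) * (Dx ^ k.2)) * Dt = (Dt ^ (k.1 + 1)) * (Dx ^ k.2) := by
      rw [mul_assoc, (hc.pow_left k.2).eq, pow_succ, mul_assoc]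
    exact congrArg (fun T : Smooth →ₗ[ℂ] Smooth => supSeminorm (T f)) this
  rw [this]
  exact withSeminorms.continuous_seminorm _

theorem continuous_Dx : Continuous Dx := by
  refine withSeminorms.continuous_of_continuous_comp Dx fun k => ?_
  have : (seminorms k).comp Dx = seminorms (k.1, k.2 + 1) := by
    ext f
    have : ((Dt ^ k.1) * (Dx ^ k.2)) * Dx = (Dt ^ k.1) * (Dx ^ (k.2 + 1)) := by
      rw [mul_assoc, pow_succ]
    exact congrArg (fun T : Smooth →ₗ[ℂ] Smooth => supSeminorm (T f)) this
  rw [this]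
  exact withSeminorms.continuous_seminorm _

theorem continuous_mul_left (ε : Smooth) : Continuous (LinearMap.mulLeft ℂ ε) := by
  have step : ∀ (T D : Smooth →ₗ[ℂ] Smooth), Continuous D →
      (∀ f g, D (f * g) = D f * g + f * D g) →
      (∀ ε, Continuous (supSeminorm.comp (T * LinearMap.mulLeft ℂ ε))) →
      ∀ ε, Continuous (supSeminorm.comp ((T * D) * LinearMap.mulLeft ℂ ε)) := by
    intro T D hD hmul hT ε
    refine Seminorm.continuous_of_le
      (q := supSeminorm.comp (T * LinearMap.mulLeft ℂ (D ε))
        + (supSeminorm.comp (T * LinearMap.mulLeft ℂ ε)).comp D)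
      ((hT (D ε)).add ((hT ε).comp hD)) fun f => ?_
    change supSeminorm (T (D (ε * f)))
      ≤ supSeminorm (T (D ε * f)) + supSeminorm (T (ε * D f))
    rw [hmul, map_add]
    exact map_add_le_add _ _ _
  have h0 : ∀ ε, Continuous (supSeminorm.comp (1 * LinearMap.mulLeft ℂ ε)) := by
    intro ε
    refine Seminorm.continuous_of_le
      (q := (supSeminorm ε).toNNReal • supSeminorm)
      ((withSeminorms.continuous_seminorm (0, 0)).const_smul _) fun f => ?_
    change (⨆ p, ‖(ε * f) p‖) ≤ ((supSeminorm ε).toNNReal : ℝ) * supSeminorm f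
    rw [Real.coe_toNNReal _ (apply_nonneg supSeminorm ε)]
    refine ciSup_le fun p => ?_
    rw [Smooth.mul_apply, norm_mul]
    exact mul_le_mul (le_ciSup ε.bddAbove p) (le_ciSup f.bddAbove p) (norm_nonneg _)
      (apply_nonneg supSeminorm ε)
  have h1 : ∀ (a : ℕ) ε, Continuous (supSeminorm.comp (Dt ^ a * LinearMap.mulLeft ℂ ε)) := by
    intro a
    induction a with
    | zero => simpa using h0
    | succ a ih => rw [pow_succ]; exact step _ _ continuous_Dt (dirD_mul _) ih
  have h2 : ∀ (a b : ℕ) ε,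
      Continuous (supSeminorm.comp ((Dt ^ a * Dx ^ b) * LinearMap.mulLeft ℂ ε)) := by
    intro a b
    induction b with
    | zero => simpa using h1 a
    | succ b ih => rw [pow_succ, ← mul_assoc]; exact step _ _ continuous_Dx (dirD_mul _) ih
  exact withSeminorms.continuous_of_continuous_comp _ fun k => h2 k.1 k.2 ε

end Functions

/-- The distributions `𝒟'(𝕋²)`: the continuous linear functionals on `C^∞(𝕋²)`. -/
abbrev Distribution : Type := Smooth →L[ℂ] ℂ

/-- `D_t` on `𝒟'(𝕋²)`: `⟨D_t u, φ⟩ = -⟨u, D_t φ⟩`. -/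
noncomputable def Distribution.Dt (u : Distribution) : Distribution :=
  -(u.comp ⟨Torus.Dt, continuous_Dt⟩)

/-- `D_x` on `𝒟'(𝕋²)`: `⟨D_x u, φ⟩ = -⟨u, D_x φ⟩`. -/
noncomputable def Distribution.Dx (u : Distribution) : Distribution :=
  -(u.comp ⟨Torus.Dx, continuous_Dx⟩)

/-- Multiplication of a distribution by a smooth function: `⟨ε u, φ⟩ = ⟨u, ε φ⟩`. -/
noncomputable def Distribution.mul (ε : Smooth) (u : Distribution) : Distribution :=
  u.comp ⟨LinearMap.mulLeft ℂ ε, continuous_mul_left ε⟩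

/-- `u ∈ C^∞(𝕋²)`: the distribution `u` is integration against a smooth function. -/
def Distribution.IsSmooth (u : Distribution) : Prop :=
  ∃ g : Smooth, ∀ φ : Smooth, u φ =
    ∫ x in (0 : ℝ)..(2 * Real.pi), ∫ t in (0 : ℝ)..(2 * Real.pi), g (t, x) * φ (t, x)

/-- An operator `L` on `𝒟'(𝕋²)` is globally hypoelliptic if `u ∈ 𝒟'(𝕋²)` and `L u ∈ C^∞(𝕋²)` imply
`u ∈ C^∞(𝕋²)`. -/
def GloballyHypoelliptic (L : Distribution → Distribution) : Prop :=
  ∀ u : Distribution, (L u).IsSmooth → u.IsSmooth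

/-- The operator `D_t + ω D_x + ε(t, x)` on `𝒟'(𝕋²)`. -/
noncomputable def perturbedField (ω : ℂ) (ε : Smooth) (u : Distribution) : Distribution :=
  u.Dt + ω • u.Dx + Distribution.mul ε u

/-- The mean `(2π)⁻² ∫₀^{2π} ∫₀^{2π} f(t, x) dt dx`. -/
noncomputable def Smooth.mean (f : Smooth) : ℂ :=
  1 / (2 * (Real.pi : ℂ)) ^ 2 *
    ∫ x in (0 : ℝ)..(2 * Real.pi), ∫ t in (0 : ℝ)..(2 * Real.pi), f (t, x)

end Torus

namespace Torus

section FourierAnalysis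

open Filter Topology

/-! ### Integration over the torus -/

/-! Everything is read off from Fourier coefficients. A distribution `u` is smooth exactly when `p ↦
u (character p)` decays faster than every power of `weight p`
(`Distribution.isSmooth_iff_rapidDecay`). An operator with constant zero-order term `ε₀` acts on
these coefficients by multiplication by `ε₀ - (m + ω n)` (`perturbedField_character`). A lower bound
by a negative power of the weight, off a finite set, therefore gives global hypoellipticity
(`globallyHypoelliptic_const`). For real `ω`, if no such bound holds, the multiplier is tiny along a
sequence of frequencies, and a distribution with coefficient 1 on that sequence and 0 elsewhere is a
counterexample (`not_globallyHypoelliptic_const`). This gives (b) ⇔ (c) for every real `α`.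

The variable term is reduced to its mean by conjugation with `exp K`, where `D_t K + ω D_x K = ε -
ε₀` (`perturbedField_mul_exp`). Solving for `K` divides the Fourier coefficients of `ε` by `m + ω
n`, which preserves rapid decay when this symbol is bounded below polynomially. For `β ≠ 0` the
symbol is elliptic; for real `ω` this is where the Diophantine hypothesis on `α` enters
(`exists_le_norm_symbol_of_not_liouville`). -/

theorem Smooth.continuous (f : Smooth) : Continuous f.1 := f.contDiff.continuous

theorem Smooth.differentiable (f : Smooth) : Differentiable ℝ f.1 :=
  f.contDiff.differentiable (by simp)

theorem Smooth.continuous_integral (f : Smooth) :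
    Continuous fun x : ℝ => ∫ t in (0 : ℝ)..(2 * Real.pi), f (t, x) :=
  intervalIntegral.continuous_parametric_intervalIntegral_of_continuous'
    (f := fun x t => f.1 (t, x)) (f.continuous.comp continuous_swap) _ _

theorem Smooth.intervalIntegrable (f : Smooth) (x a b : ℝ) :
    IntervalIntegrable (fun t => f (t, x)) MeasureTheory.volume a b :=
  (f.continuous.comp (by fun_prop : Continuous fun t : ℝ => (t, x))).intervalIntegrable _ _

theorem norm_le_supSeminorm (f : Smooth) (p : ℝ × ℝ) : ‖f p‖ ≤ supSeminorm f :=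
  le_ciSup f.bddAbove p

/-- The integral over the torus. -/
noncomputable def integral : Smooth →ₗ[ℂ] ℂ where
  toFun f := ∫ x in (0 : ℝ)..(2 * Real.pi), ∫ t in (0 : ℝ)..(2 * Real.pi), f (t, x)
  map_add' f g := by
    rw [← intervalIntegral.integral_add (f.continuous_integral.intervalIntegrable _ _)
      (g.continuous_integral.intervalIntegrable _ _)]
    refine intervalIntegral.integral_congr fun x _ => ?_
    exact intervalIntegral.integral_add (f.intervalIntegrable x _ _) (g.intervalIntegrable x _ _)
  map_smul' c f := by
    simp only [Smooth.smul_apply, intervalIntegral.integral_const_mul]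
    rfl

theorem integral_apply (f : Smooth) : integral f =
    ∫ x in (0 : ℝ)..(2 * Real.pi), ∫ t in (0 : ℝ)..(2 * Real.pi), f (t, x) := rfl

theorem norm_integral_le (f : Smooth) :
    ‖integral f‖ ≤ (2 * Real.pi) ^ 2 * supSeminorm f := by
  have hpi : |2 * Real.pi - 0| = 2 * Real.pi := by
    rw [sub_zero, abs_of_pos Real.two_pi_pos]
  have h1 : ∀ x : ℝ, ‖∫ t in (0 : ℝ)..(2 * Real.pi), f (t, x)‖
      ≤ supSeminorm f * (2 * Real.pi) := fun x => by
    have := intervalIntegral.norm_integral_le_of_norm_le_const (a := 0) (b := 2 * Real.pi)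
      (f := fun t => f (t, x)) fun t _ => norm_le_supSeminorm f (t, x)
    rwa [hpi] at this
  have := intervalIntegral.norm_integral_le_of_norm_le_const (a := 0) (b := 2 * Real.pi)
    fun x _ => h1 x
  rw [hpi] at this
  refine this.trans_eq (by ring)

theorem integral_Dt (f : Smooth) : integral (Dt f) = 0 := by
  rw [integral_apply]
  have : ∀ x : ℝ, ∫ t in (0 : ℝ)..(2 * Real.pi), (Dt f) (t, x) = 0 := by
    intro x
    have hd : ∀ t : ℝ, HasDerivAt (fun s => f.1 (s, x)) (fderiv ℝ f.1 (t, x) (1, 0)) t := by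
      intro t
      exact (f.differentiable (t, x)).hasFDerivAt.comp_hasDerivAt t
        ((hasDerivAt_id t).prodMk (hasDerivAt_const t x))
    have hc : Continuous fun t : ℝ => fderiv ℝ f.1 (t, x) (1, 0) :=
      ((f.contDiff.continuous_fderiv (by simp)).comp (by fun_prop)).clm_apply continuous_const
    change ∫ t in (0 : ℝ)..(2 * Real.pi), -Complex.I * fderiv ℝ f.1 (t, x) (1, 0) = 0
    rw [intervalIntegral.integral_const_mul,
      intervalIntegral.integral_eq_sub_of_hasDerivAt (fun t _ => hd t) (hc.intervalIntegrable _ _)]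
    have := f.2.2.1 0 x
    rw [zero_add] at this
    simp [this]
  simp [this]

theorem integral_swap (f : Smooth) : integral f =
    ∫ t in (0 : ℝ)..(2 * Real.pi), ∫ x in (0 : ℝ)..(2 * Real.pi), f (t, x) := by
  rw [integral_apply]
  have hle : (0 : ℝ) ≤ 2 * Real.pi := Real.two_pi_pos.le
  simp only [intervalIntegral.integral_of_le hle]
  refine MeasureTheory.integral_integral_swap (f := fun x t => f.1 (t, x)) ?_
  rw [MeasureTheory.Measure.prod_restrict]
  refine MeasureTheory.IntegrableOn.mono_set ?_
    (Set.prod_mono Set.Ioc_subset_Icc_self Set.Ioc_subset_Icc_self)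
  exact (f.continuous.comp continuous_swap).continuousOn.integrableOn_compact
    (isCompact_Icc.prod isCompact_Icc)

theorem integral_Dx (f : Smooth) : integral (Dx f) = 0 := by
  rw [integral_swap]
  have : ∀ t : ℝ, ∫ x in (0 : ℝ)..(2 * Real.pi), (Dx f) (t, x) = 0 := by
    intro t
    have hd : ∀ x : ℝ, HasDerivAt (fun s => f.1 (t, s)) (fderiv ℝ f.1 (t, x) (0, 1)) x := by
      intro x
      exact (f.differentiable (t, x)).hasFDerivAt.comp_hasDerivAt x
        ((hasDerivAt_const x t).prodMk (hasDerivAt_id x))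
    have hc : Continuous fun x : ℝ => fderiv ℝ f.1 (t, x) (0, 1) :=
      ((f.contDiff.continuous_fderiv (by simp)).comp (by fun_prop)).clm_apply continuous_const
    change ∫ x in (0 : ℝ)..(2 * Real.pi), -Complex.I * fderiv ℝ f.1 (t, x) (0, 1) = 0
    rw [intervalIntegral.integral_const_mul,
      intervalIntegral.integral_eq_sub_of_hasDerivAt (fun t _ => hd t) (hc.intervalIntegrable _ _)]
    have := f.2.2.2 t 0
    rw [zero_add] at this
    simp [this]
  simp [this]

theorem Dt_mul (f g : Smooth) : Dt (f * g) = Dt f * g + f * Dt g := dirD_mul _ f g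

theorem Dx_mul (f g : Smooth) : Dx (f * g) = Dx f * g + f * Dx g := dirD_mul _ f g

theorem integral_Dt_mul (f g : Smooth) : integral (Dt f * g) = -integral (f * Dt g) := by
  have := integral_Dt (f * g)
  rw [Dt_mul, map_add] at this
  exact eq_neg_of_add_eq_zero_left this

theorem integral_Dx_mul (f g : Smooth) : integral (Dx f * g) = -integral (f * Dx g) := by
  have := integral_Dx (f * g)
  rw [Dx_mul, map_add] at this
  exact eq_neg_of_add_eq_zero_left this

theorem continuous_supSeminorm : Continuous supSeminorm :=
  withSeminorms.continuous_seminorm (0, 0)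

theorem continuous_of_norm_le {u : Smooth →ₗ[ℂ] ℂ} {q : Seminorm ℂ Smooth} (hq : Continuous q)
    (h : ∀ f, ‖u f‖ ≤ q f) : Continuous u :=
  (norm_withSeminorms ℂ ℂ).continuous_of_continuous_comp u fun _ =>
    Seminorm.continuous_of_le hq h

/-- Integration over the torus, as a distribution. -/
noncomputable def integralDistribution : Distribution :=
  ⟨integral, continuous_of_norm_le (q := ((2 * Real.pi).toNNReal ^ 2) • supSeminorm)
    (continuous_supSeminorm.const_smul _) fun f => by
      refine (norm_integral_le f).trans_eq ?_
      change _ = (((2 * Real.pi).toNNReal ^ 2 : NNReal) : ℝ) * supSeminorm f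
      rw [NNReal.coe_pow, Real.coe_toNNReal _ Real.two_pi_pos.le]⟩

theorem Distribution.mul_apply (g : Smooth) (u : Distribution) (φ : Smooth) :
    Distribution.mul g u φ = u (g * φ) := rfl

theorem Distribution.mul_mul (f g : Smooth) (u : Distribution) :
    Distribution.mul f (Distribution.mul g u) = Distribution.mul (f * g) u := by
  ext φ
  simp only [Distribution.mul_apply]
  congr 1
  ring

theorem Distribution.one_mul (u : Distribution) : Distribution.mul 1 u = u := by
  ext φ
  rw [Distribution.mul_apply, _root_.one_mul]

theorem Distribution.isSmooth_iff (u : Distribution) :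
    u.IsSmooth ↔ ∃ g, u = Distribution.mul g integralDistribution :=
  exists_congr fun _ => ⟨fun h => ContinuousLinearMap.ext h, fun h φ => DFunLike.congr_fun h φ⟩

theorem Distribution.IsSmooth.mul {u : Distribution} (hu : u.IsSmooth) (f : Smooth) :
    (Distribution.mul f u).IsSmooth := by
  rw [Distribution.isSmooth_iff] at hu ⊢
  obtain ⟨g, rfl⟩ := hu
  exact ⟨f * g, Distribution.mul_mul _ _ _⟩

/-! ### Characters -/

/-- The phase `i (m t + n x)`, linear in `(t, x)`. -/
noncomputable def phase (p : ℤ × ℤ) : ℝ × ℝ →L[ℝ] ℂ :=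
  ((Complex.I * p.1) • Complex.ofRealCLM).comp (ContinuousLinearMap.fst ℝ ℝ ℝ) +
    ((Complex.I * p.2) • Complex.ofRealCLM).comp (ContinuousLinearMap.snd ℝ ℝ ℝ)

theorem phase_apply (p : ℤ × ℤ) (q : ℝ × ℝ) :
    phase p q = Complex.I * p.1 * q.1 + Complex.I * p.2 * q.2 := rfl

theorem phase_add (p q : ℤ × ℤ) (z : ℝ × ℝ) : phase (p + q) z = phase p z + phase q z := by
  simp only [phase_apply, Prod.fst_add, Prod.snd_add, Int.cast_add]
  ring

/-- The character `exp (i (m t + n x))`. -/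
noncomputable def character (p : ℤ × ℤ) : Smooth :=
  ⟨fun z => Complex.exp (phase p z), (phase p).contDiff.cexp, fun t x => by
    have : phase p (t + 2 * Real.pi, x) = phase p (t, x) + p.1 * (2 * Real.pi * Complex.I) := by
      simp only [phase_apply]; push_cast; ring
    simp only [this, Complex.exp_add, Complex.exp_int_mul_two_pi_mul_I, mul_one], fun t x => by
    have : phase p (t, x + 2 * Real.pi) = phase p (t, x) + p.2 * (2 * Real.pi * Complex.I) := by
      simp only [phase_apply]; push_cast; ring
    simp only [this, Complex.exp_add, Complex.exp_int_mul_two_pi_mul_I, mul_one]⟩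

theorem character_apply (p : ℤ × ℤ) (z : ℝ × ℝ) : character p z = Complex.exp (phase p z) := rfl

theorem norm_character (p : ℤ × ℤ) (z : ℝ × ℝ) : ‖character p z‖ = 1 := by
  rw [character_apply, phase_apply, Complex.norm_exp]
  simp

theorem character_add (p q : ℤ × ℤ) : character (p + q) = character p * character q :=
  Smooth.ext fun z => by
    simp only [Smooth.mul_apply, character_apply, phase_add, Complex.exp_add]

theorem character_zero : character 0 = 1 :=
  Smooth.ext fun z => by
    change Complex.exp (phase 0 z) = 1
    simp [phase_apply]

theorem hasFDerivAt_character (p : ℤ × ℤ) (z : ℝ × ℝ) :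
    HasFDerivAt (character p).1 (character p z • phase p) z :=
  (phase p).hasFDerivAt.cexp

theorem dirD_character (v : ℝ × ℝ) (p : ℤ × ℤ) :
    dirD v (character p) = (-Complex.I * phase p v) • character p :=
  Smooth.ext fun z => by
    rw [dirD_apply, (hasFDerivAt_character p z).fderiv, Smooth.smul_apply]
    simp only [smul_apply, smul_eq_mul]
    ring

theorem Dt_character (p : ℤ × ℤ) : Dt (character p) = (p.1 : ℂ) • character p := by
  rw [Dt, dirD_character, phase_apply]
  congr 1
  push_cast
  linear_combination (-(p.1 : ℂ)) * Complex.I_mul_I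

theorem Dx_character (p : ℤ × ℤ) : Dx (character p) = (p.2 : ℂ) • character p := by
  rw [Dx, dirD_character, phase_apply]
  congr 1
  push_cast
  linear_combination (-(p.2 : ℂ)) * Complex.I_mul_I

theorem integral_one : integral 1 = (2 * Real.pi) ^ 2 := by
  change ∫ x in (0 : ℝ)..(2 * Real.pi), ∫ t in (0 : ℝ)..(2 * Real.pi), (1 : ℂ) = _
  simp
  ring

theorem integral_character_zero : integral (character 0) = (2 * Real.pi) ^ 2 := by
  rw [character_zero, integral_one]

/-- A character is an eigenvector of `Dt` and `Dx`, and derivatives integrate to zero, so a nonzero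
eigenvalue kills the integral. -/
theorem integral_character_of_ne {p : ℤ × ℤ} (hp : p ≠ 0) : integral (character p) = 0 := by
  have ht := integral_Dt (character p)
  have hx := integral_Dx (character p)
  rw [Dt_character, map_smul, smul_eq_mul, mul_eq_zero, Int.cast_eq_zero] at ht
  rw [Dx_character, map_smul, smul_eq_mul, mul_eq_zero, Int.cast_eq_zero] at hx
  by_contra h
  exact hp (Prod.ext (ht.resolve_right h) (hx.resolve_right h))

/-! ### Fourier coefficients -/

/-- The unnormalised Fourier coefficient `∬ f e_p` of a smooth function. -/
noncomputable def coeff (f : Smooth) (p : ℤ × ℤ) : ℂ := integral (f * character p)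

/-- The sign appears because `coeff` pairs with the character itself, not its conjugate: `coeff f p`
is the usual coefficient at `-p`. -/
theorem coeff_Dt (f : Smooth) (p : ℤ × ℤ) : coeff (Dt f) p = -p.1 * coeff f p := by
  rw [coeff, integral_Dt_mul, Dt_character, mul_smul_comm, map_smul, smul_eq_mul, coeff, neg_mul]

theorem coeff_Dx (f : Smooth) (p : ℤ × ℤ) : coeff (Dx f) p = -p.2 * coeff f p := by
  rw [coeff, integral_Dx_mul, Dx_character, mul_smul_comm, map_smul, smul_eq_mul, coeff, neg_mul]

theorem coeff_add (f g : Smooth) (p : ℤ × ℤ) : coeff (f + g) p = coeff f p + coeff g p := by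
  rw [coeff, add_mul, map_add]; rfl

theorem coeff_smul (c : ℂ) (f : Smooth) (p : ℤ × ℤ) : coeff (c • f) p = c * coeff f p := by
  rw [coeff, smul_mul_assoc, map_smul]; rfl

theorem coeff_sub (f g : Smooth) (p : ℤ × ℤ) : coeff (f - g) p = coeff f p - coeff g p := by
  rw [coeff, sub_mul, map_sub]; rfl

/-- On the circle, a continuous function with summable Fourier coefficients is the sum of its
Fourier series, here the zero series. -/
theorem eq_zero_of_integral_mul_exp_eq_zero {f : ℝ → ℂ} (hf : Continuous f)
    (hper : Function.Periodic f (2 * Real.pi))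
    (h : ∀ n : ℤ, ∫ s in (0 : ℝ)..(2 * Real.pi), f s * Complex.exp (Complex.I * n * s) = 0) :
    f = 0 := by
  have : Fact (0 < 2 * Real.pi) := ⟨Real.two_pi_pos⟩
  let F : C(AddCircle (2 * Real.pi), ℂ) := ⟨hper.lift, continuous_coinduced_dom.2 hf⟩
  have hF : fourierCoeff F = 0 := by
    ext n
    rw [fourierCoeff_eq_intervalIntegral F n 0, zero_add]
    have : ∀ s : ℝ, fourier (-n) (s : AddCircle (2 * Real.pi)) • F s
        = f s * Complex.exp (Complex.I * (-n : ℤ) * s) := by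
      intro s
      rw [fourier_coe_apply, smul_eq_mul, mul_comm]
      congr 2
      have : (Real.pi : ℂ) ≠ 0 := Complex.ofReal_ne_zero.2 Real.pi_ne_zero
      push_cast
      field_simp
    simp only [this, h, smul_zero, Pi.zero_apply]
  have hs := hasSum_fourier_series_of_summable (f := F) (by rw [hF]; exact summable_zero)
  simp only [hF, Pi.zero_apply, zero_smul] at hs
  have hF0 : F = 0 := hs.unique hasSum_zero
  ext s
  exact DFunLike.congr_fun hF0 (s : AddCircle (2 * Real.pi))

theorem Smooth.eq_zero_of_coeff_eq_zero {f : Smooth} (h : ∀ p, coeff f p = 0) : f = 0 := by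
  -- Uniqueness on the circle is used twice: in `x` for the partial coefficient of order `m` in `t`,
  -- then in `t` for each fixed `x`.
  have inner : ∀ m : ℤ, (fun x : ℝ => ∫ t in (0 : ℝ)..(2 * Real.pi),
      f (t, x) * Complex.exp (Complex.I * m * t)) = 0 := by
    intro m
    have he : ∀ t x : ℝ, f (t, x) * Complex.exp (Complex.I * m * t)
        = (f * character (m, 0)) (t, x) := fun t x => by
      rw [Smooth.mul_apply, character_apply, phase_apply]
      simp
    refine eq_zero_of_integral_mul_exp_eq_zero ?_ (fun x => ?_) fun n => ?_
    · simp only [he]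
      exact (f * character (m, 0)).continuous_integral
    · simp only [he]
      congr 1
      ext t
      exact (f * character (m, 0)).2.2.2 t x
    · rw [← h (m, n), coeff, integral_apply]
      refine intervalIntegral.integral_congr fun x _ => ?_
      simp only [← intervalIntegral.integral_mul_const]
      refine intervalIntegral.integral_congr fun t _ => ?_
      simp only [Smooth.mul_apply, character_apply, phase_apply, Complex.exp_add]
      ring
  have outer : ∀ x : ℝ, (fun t : ℝ => f (t, x)) = 0 := fun x =>
    eq_zero_of_integral_mul_exp_eq_zero (f.continuous.comp (by fun_prop)) (fun t => f.2.2.1 t x)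
      fun m => congrFun (inner m) x
  exact Smooth.ext fun p => congrFun (outer p.2) p.1

theorem Smooth.ext_coeff {f g : Smooth} (h : ∀ p, coeff f p = coeff g p) : f = g :=
  sub_eq_zero.1 (Smooth.eq_zero_of_coeff_eq_zero fun p => by rw [coeff_sub, h, sub_self])

/-! ### Rapidly decreasing families on `ℤ²` -/

/-- The weight `1 + m² + n²`. -/
noncomputable def weight (p : ℤ × ℤ) : ℝ := 1 + (p.1 : ℝ) ^ 2 + (p.2 : ℝ) ^ 2

theorem one_le_weight (p : ℤ × ℤ) : 1 ≤ weight p := by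
  unfold weight; nlinarith [sq_nonneg (p.1 : ℝ), sq_nonneg (p.2 : ℝ)]

theorem weight_pos (p : ℤ × ℤ) : 0 < weight p := one_pos.trans_le (one_le_weight p)

theorem weight_neg (p : ℤ × ℤ) : weight (-p) = weight p := by simp [weight]

theorem norm_fst_le_weight (p : ℤ × ℤ) : ‖(p.1 : ℂ)‖ ≤ weight p := by
  rw [Complex.norm_intCast, weight]
  nlinarith [sq_abs (p.1 : ℝ), sq_nonneg (|(p.1 : ℝ)| - 1), sq_nonneg (p.2 : ℝ)]

theorem norm_snd_le_weight (p : ℤ × ℤ) : ‖(p.2 : ℂ)‖ ≤ weight p := by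
  rw [Complex.norm_intCast, weight]
  nlinarith [sq_abs (p.2 : ℝ), sq_nonneg (|(p.2 : ℝ)| - 1), sq_nonneg (p.1 : ℝ)]

/-- The comparison is `(1 + m²)(1 + n²) ≤ (1 + m² + n²)²`, which splits the sum into a product of
two convergent ones. -/
theorem summable_inv_weight_sq : Summable fun p : ℤ × ℤ => (weight p ^ 2)⁻¹ := by
  have h : Summable fun m : ℤ => (1 + (m : ℝ) ^ 2)⁻¹ := by
    refine Summable.of_norm_bounded_eventually (g := fun m : ℤ => 1 / (m : ℝ) ^ 2)
      (Real.summable_one_div_int_pow.2 one_lt_two) ?_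
    filter_upwards [(Set.finite_singleton (0 : ℤ)).compl_mem_cofinite] with m hm
    have hm : (m : ℝ) ≠ 0 := Int.cast_ne_zero.2 hm
    rw [one_div, Real.norm_of_nonneg (by positivity)]
    exact inv_anti₀ (by positivity) (by linarith)
  refine Summable.of_nonneg_of_le (fun p => by positivity) (fun p => ?_)
    (h.mul_of_nonneg h (fun m => by positivity) fun m => by positivity)
  rw [← mul_inv]
  refine inv_anti₀ (by positivity) ?_
  rw [weight]
  nlinarith [sq_nonneg (p.1 : ℝ), sq_nonneg (p.2 : ℝ),
    mul_nonneg (sq_nonneg (p.1 : ℝ)) (sq_nonneg (p.2 : ℝ))]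

/-- Decay faster than every power of the weight. -/
def RapidDecay (a : ℤ × ℤ → ℂ) : Prop := ∀ N : ℕ, ∃ C : ℝ, ∀ p, ‖a p‖ * weight p ^ N ≤ C

theorem rapidDecay_of_eventually {a : ℤ × ℤ → ℂ}
    (h : ∀ N : ℕ, ∃ C : ℝ, ∀ᶠ p in cofinite, ‖a p‖ * weight p ^ N ≤ C) : RapidDecay a := by
  intro N
  obtain ⟨C, hC⟩ := h N
  obtain ⟨B, hB⟩ := (Set.Finite.image (fun p => ‖a p‖ * weight p ^ N)
    (eventually_cofinite.1 hC)).bddAbove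
  refine ⟨max C B, fun p => ?_⟩
  by_cases hp : ‖a p‖ * weight p ^ N ≤ C
  · exact le_max_of_le_left hp
  · exact le_max_of_le_right (hB ⟨p, hp, rfl⟩)

/-- Polynomial losses and finitely many exceptional frequencies do not affect rapid decay; divisions
by small symbols are absorbed this way. -/
theorem RapidDecay.of_eventually_le {a b : ℤ × ℤ → ℂ} (ha : RapidDecay a) {C : ℝ} {M : ℕ}
    (h : ∀ᶠ p in cofinite, ‖b p‖ ≤ C * weight p ^ M * ‖a p‖) : RapidDecay b := by
  refine rapidDecay_of_eventually fun N => ?_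
  obtain ⟨B, hB⟩ := ha (M + N)
  refine ⟨|C| * B, h.mono fun p hp => ?_⟩
  have hw := weight_pos p
  calc ‖b p‖ * weight p ^ N ≤ C * weight p ^ M * ‖a p‖ * weight p ^ N := by gcongr
    _ = C * (‖a p‖ * weight p ^ (M + N)) := by ring
    _ ≤ |C| * (‖a p‖ * weight p ^ (M + N)) := by gcongr; exact le_abs_self C
    _ ≤ |C| * B := by gcongr; exact hB p

theorem RapidDecay.of_le {a b : ℤ × ℤ → ℂ} (ha : RapidDecay a) {C : ℝ} {M : ℕ}
    (h : ∀ p, ‖b p‖ ≤ C * weight p ^ M * ‖a p‖) : RapidDecay b :=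
  ha.of_eventually_le (Eventually.of_forall h)

theorem RapidDecay.comp_neg {a : ℤ × ℤ → ℂ} (ha : RapidDecay a) : RapidDecay fun p => a (-p) :=
  fun N => (ha N).imp fun C hC p => by rw [← weight_neg]; exact hC (-p)

theorem RapidDecay.const_mul {a : ℤ × ℤ → ℂ} (ha : RapidDecay a) (c : ℂ) :
    RapidDecay fun p => c * a p :=
  ha.of_le (C := ‖c‖) (M := 0) fun p => by rw [norm_mul, pow_zero, mul_one]

theorem RapidDecay.fst_mul {a : ℤ × ℤ → ℂ} (ha : RapidDecay a) :
    RapidDecay fun p => p.1 * a p :=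
  ha.of_le (C := 1) (M := 1) fun p => by
    rw [norm_mul, one_mul, pow_one]; gcongr; exact norm_fst_le_weight p

theorem RapidDecay.snd_mul {a : ℤ × ℤ → ℂ} (ha : RapidDecay a) :
    RapidDecay fun p => p.2 * a p :=
  ha.of_le (C := 1) (M := 1) fun p => by
    rw [norm_mul, one_mul, pow_one]; gcongr; exact norm_snd_le_weight p

theorem RapidDecay.summable_norm {a : ℤ × ℤ → ℂ} (ha : RapidDecay a) :
    Summable fun p => ‖a p‖ := by
  obtain ⟨C, hC⟩ := ha 2
  refine Summable.of_nonneg_of_le (fun p => norm_nonneg _) (fun p => ?_)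
    (summable_inv_weight_sq.mul_left C)
  have := weight_pos p
  rw [← div_eq_mul_inv, le_div_iff₀ (by positivity)]
  exact hC p

/-! ### Decay of Fourier coefficients -/

/-- The operator `1 + D_t² + D_x²`. -/
noncomputable def bessel : Smooth →ₗ[ℂ] Smooth := 1 + Dt ^ 2 + Dx ^ 2

theorem bessel_apply (f : Smooth) : bessel f = f + Dt (Dt f) + Dx (Dx f) := rfl

theorem continuous_bessel : Continuous bessel := by
  change Continuous fun f => f + Dt (Dt f) + Dx (Dx f)
  exact (continuous_id.add (continuous_Dt.comp continuous_Dt)).add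
    (continuous_Dx.comp continuous_Dx)

theorem continuous_bessel_pow (N : ℕ) : Continuous (bessel ^ N : Smooth →ₗ[ℂ] Smooth) := by
  rw [Module.End.coe_pow]
  exact continuous_bessel.iterate N

theorem coeff_bessel_pow (N : ℕ) (f : Smooth) (p : ℤ × ℤ) :
    coeff ((bessel ^ N) f) p = (weight p : ℂ) ^ N * coeff f p := by
  induction N with
  | zero => simp
  | succ N ih =>
    rw [pow_succ', Module.End.mul_apply, bessel_apply, coeff_add, coeff_add, coeff_Dt, coeff_Dt,
      coeff_Dx, coeff_Dx, ih, weight]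
    push_cast
    ring

theorem supSeminorm_mul_character_le (f : Smooth) (p : ℤ × ℤ) :
    supSeminorm (f * character p) ≤ supSeminorm f :=
  ciSup_le fun z => by
    rw [Smooth.mul_apply, norm_mul, norm_character, mul_one]
    exact norm_le_supSeminorm f z

/-- Integration by parts: on coefficients, `bessel` is multiplication by the weight. The bound is a
continuous seminorm of `f`, which later yields continuity of functionals defined by coefficients. -/
theorem norm_coeff_mul_weight_pow_le (N : ℕ) (f : Smooth) (p : ℤ × ℤ) :
    ‖coeff f p‖ * weight p ^ N ≤ (2 * Real.pi) ^ 2 * supSeminorm ((bessel ^ N) f) := by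
  have h : ‖coeff ((bessel ^ N) f) p‖ ≤ (2 * Real.pi) ^ 2 * supSeminorm ((bessel ^ N) f) :=
    (norm_integral_le _).trans (by gcongr; exact supSeminorm_mul_character_le _ _)
  rw [coeff_bessel_pow, norm_mul, norm_pow, Complex.norm_real,
    Real.norm_of_nonneg (weight_pos p).le] at h
  rwa [mul_comm]

theorem rapidDecay_coeff (f : Smooth) : RapidDecay (coeff f) := fun N =>
  ⟨_, norm_coeff_mul_weight_pow_le N f⟩

/-! ### Fourier series -/

/-- The derivative is written through series of the same kind, with coefficients `m a` and `n a`, so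
that smoothness follows by induction over all rapidly decreasing families. -/
theorem RapidDecay.hasFDerivAt_tsum {a : ℤ × ℤ → ℂ} (ha : RapidDecay a) (z : ℝ × ℝ) :
    HasFDerivAt (fun z => ∑' p, a p * character p z)
      ((Complex.I * ∑' p, p.1 * a p * character p z) •
          Complex.ofRealCLM.comp (ContinuousLinearMap.fst ℝ ℝ ℝ) +
        (Complex.I * ∑' p, p.2 * a p * character p z) •
          Complex.ofRealCLM.comp (ContinuousLinearMap.snd ℝ ℝ ℝ)) z := by
  have hs : ∀ {b : ℤ × ℤ → ℂ}, RapidDecay b → Summable fun p => b p * character p z := fun hb =>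
    Summable.of_norm (hb.summable_norm.congr fun p => by rw [norm_mul, norm_character, mul_one])
  let T := Complex.ofRealCLM.comp (ContinuousLinearMap.fst ℝ ℝ ℝ)
  let X := Complex.ofRealCLM.comp (ContinuousLinearMap.snd ℝ ℝ ℝ)
  have hphase : ∀ p : ℤ × ℤ, phase p = (Complex.I * p.1) • T + (Complex.I * p.2) • X :=
    fun p => rfl
  have hd : ∀ (p : ℤ × ℤ) z, HasFDerivAt (fun z => a p * character p z)
      ((Complex.I * (p.1 * a p * character p z)) • T +
        (Complex.I * (p.2 * a p * character p z)) • X) z := by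
    intro p z
    refine ((hasFDerivAt_character p z).const_mul (a p)).congr_fderiv ?_
    rw [hphase, smul_add, smul_add, smul_smul, smul_smul, smul_smul, smul_smul]
    congr 2 <;> ring
  have hT : ‖T‖ ≤ 1 := ContinuousLinearMap.opNorm_le_bound _ zero_le_one fun z => by
    rw [one_mul]
    exact (Complex.norm_real _).trans_le (norm_fst_le z)
  have hX : ‖X‖ ≤ 1 := ContinuousLinearMap.opNorm_le_bound _ zero_le_one fun z => by
    rw [one_mul]
    exact (Complex.norm_real _).trans_le (norm_snd_le z)
  refine (_root_.hasFDerivAt_tsum (ha.fst_mul.summable_norm.add ha.snd_mul.summable_norm) hd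
    (fun p z => ?_) (hs ha) z).congr_fderiv ?_
  · refine (norm_add_le _ _).trans (add_le_add ?_ ?_)
    · rw [norm_smul, norm_mul, norm_mul _ (character p z), norm_character, Complex.norm_I, one_mul,
        mul_one]
      exact mul_le_of_le_one_right (norm_nonneg _) hT
    · rw [norm_smul, norm_mul, norm_mul _ (character p z), norm_character, Complex.norm_I, one_mul,
        mul_one]
      exact mul_le_of_le_one_right (norm_nonneg _) hX
  · have s1 := ((hs ha.fst_mul).mul_left Complex.I)
    have s2 := ((hs ha.snd_mul).mul_left Complex.I)
    rw [Summable.tsum_add (s1.smul_const T) (s2.smul_const X), s1.tsum_smul_const,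
      s2.tsum_smul_const, tsum_mul_left, tsum_mul_left]

open scoped ContDiff in
theorem RapidDecay.contDiff_tsum {a : ℤ × ℤ → ℂ} (ha : RapidDecay a) :
    ContDiff ℝ ∞ fun z => ∑' p, a p * character p z := by
  refine contDiff_infty.2 fun n => ?_
  induction n generalizing a with
  | zero =>
    exact contDiff_zero.2 (continuous_iff_continuousAt.2 fun z =>
      (ha.hasFDerivAt_tsum z).continuousAt)
  | succ n ih =>
    exact contDiff_succ_iff_hasFDerivAt.2 ⟨_,
      ((contDiff_const.mul (ih ha.fst_mul)).smul contDiff_const).add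
        ((contDiff_const.mul (ih ha.snd_mul)).smul contDiff_const), ha.hasFDerivAt_tsum⟩

/-- The sum of a Fourier series with rapidly decreasing coefficients. -/
noncomputable def RapidDecay.series {a : ℤ × ℤ → ℂ} (ha : RapidDecay a) : Smooth :=
  ⟨fun z => ∑' p, a p * character p z, ha.contDiff_tsum,
    fun t x => tsum_congr fun p => congrArg (a p * ·) ((character p).2.2.1 t x),
    fun t x => tsum_congr fun p => congrArg (a p * ·) ((character p).2.2.2 t x)⟩

theorem sum_smul_character_apply (a : ℤ × ℤ → ℂ) (s : Finset (ℤ × ℤ)) (z : ℝ × ℝ) :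
    (∑ p ∈ s, a p • character p) z = ∑ p ∈ s, a p * character p z := by
  classical
  induction s using Finset.induction_on with
  | empty => rfl
  | insert p s hp ih => rw [Finset.sum_insert hp, Finset.sum_insert hp, Smooth.add_apply, ih]; rfl

theorem RapidDecay.tendsto_supSeminorm {a : ℤ × ℤ → ℂ} (ha : RapidDecay a) :
    Tendsto (fun s : Finset (ℤ × ℤ) => supSeminorm (∑ p ∈ s, a p • character p - ha.series))
      atTop (𝓝 0) := by
  have h := tendstoUniformly_tsum ha.summable_norm (f := fun p z => a p * character p z)
    fun p z => by rw [norm_mul, norm_character, mul_one]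
  rw [Metric.tendstoUniformly_iff] at h
  refine Metric.tendsto_nhds.2 fun ε hε => ?_
  filter_upwards [h (ε / 2) (half_pos hε)] with s hs
  rw [dist_zero_right, Real.norm_of_nonneg (apply_nonneg _ _)]
  refine (ciSup_le fun z => ?_).trans_lt (half_lt_self hε)
  have := (hs z).le
  rw [dist_eq_norm, norm_sub_rev] at this
  change ‖(∑ p ∈ s, a p • character p) z - ha.series z‖ ≤ ε / 2
  rwa [sum_smul_character_apply]

theorem coeff_sum_smul_character (a : ℤ × ℤ → ℂ) (s : Finset (ℤ × ℤ)) (q : ℤ × ℤ) :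
    coeff (∑ p ∈ s, a p • character p) q = if -q ∈ s then a (-q) * (2 * Real.pi) ^ 2 else 0 := by
  classical
  rw [coeff, Finset.sum_mul, map_sum, ← Finset.sum_ite_eq' s (-q) fun p => a p * (2 * Real.pi) ^ 2]
  refine Finset.sum_congr rfl fun p _ => ?_
  rw [smul_mul_assoc, map_smul, ← character_add, smul_eq_mul]
  split_ifs with h
  · rw [h, neg_add_cancel, integral_character_zero]
  · rw [integral_character_of_ne fun h' => h (eq_neg_of_add_eq_zero_left h'), mul_zero]

theorem RapidDecay.coeff_series {a : ℤ × ℤ → ℂ} (ha : RapidDecay a) (q : ℤ × ℤ) :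
    coeff ha.series q = (2 * Real.pi) ^ 2 * a (-q) := by
  have h : Tendsto (fun s : Finset (ℤ × ℤ) => coeff (∑ p ∈ s, a p • character p) q) atTop
      (𝓝 (coeff ha.series q)) := by
    rw [tendsto_iff_norm_sub_tendsto_zero]
    refine squeeze_zero (fun s => norm_nonneg _) (fun s => ?_)
      (by simpa using ha.tendsto_supSeminorm.const_mul ((2 * Real.pi) ^ 2))
    rw [← coeff_sub]
    exact (norm_integral_le _).trans (by gcongr; exact supSeminorm_mul_character_le _ _)
  refine tendsto_nhds_unique h (tendsto_const_nhds.congr' ?_)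
  filter_upwards [eventually_ge_atTop {-q}] with s hs
  rw [coeff_sum_smul_character, if_pos (hs (Finset.mem_singleton_self _)), mul_comm]

/-- The normalised Fourier coefficients, those with `f = ∑ fourier f p • character p`. -/
noncomputable def fourier (f : Smooth) (p : ℤ × ℤ) : ℂ := ((2 * (Real.pi : ℂ)) ^ 2)⁻¹ * coeff f (-p)

theorem two_pi_sq_ne_zero : (2 * (Real.pi : ℂ)) ^ 2 ≠ 0 :=
  pow_ne_zero _ (mul_ne_zero two_ne_zero (Complex.ofReal_ne_zero.2 Real.pi_ne_zero))

theorem rapidDecay_fourier (f : Smooth) : RapidDecay (fourier f) :=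
  (rapidDecay_coeff f).comp_neg.const_mul _

theorem series_fourier (f : Smooth) : (rapidDecay_fourier f).series = f :=
  Smooth.ext_coeff fun p => by
    rw [RapidDecay.coeff_series, fourier, neg_neg, mul_inv_cancel_left₀ two_pi_sq_ne_zero]

theorem fourier_Dt (f : Smooth) (p : ℤ × ℤ) : fourier (Dt f) p = p.1 * fourier f p := by
  rw [fourier, coeff_Dt, fourier, Prod.fst_neg, Int.cast_neg]
  ring

theorem fourier_Dx (f : Smooth) (p : ℤ × ℤ) : fourier (Dx f) p = p.2 * fourier f p := by
  rw [fourier, coeff_Dx, fourier, Prod.snd_neg, Int.cast_neg]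
  ring

theorem RapidDecay.fourier_series {a : ℤ × ℤ → ℂ} (ha : RapidDecay a) (p : ℤ × ℤ) :
    fourier ha.series p = a p := by
  rw [fourier, coeff_series, neg_neg, inv_mul_cancel_left₀ two_pi_sq_ne_zero]

theorem fourier_add (f g : Smooth) (p : ℤ × ℤ) :
    fourier (f + g) p = fourier f p + fourier g p := by
  rw [fourier, coeff_add, mul_add]; rfl

theorem fourier_sub (f g : Smooth) (p : ℤ × ℤ) :
    fourier (f - g) p = fourier f p - fourier g p := by
  rw [fourier, coeff_sub, mul_sub]; rfl

theorem fourier_smul (c : ℂ) (f : Smooth) (p : ℤ × ℤ) : fourier (c • f) p = c * fourier f p := by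
  rw [fourier, coeff_smul, mul_left_comm]; rfl

theorem fourier_character (q p : ℤ × ℤ) :
    fourier (character q) p = if p = q then 1 else 0 := by
  rw [fourier, coeff, ← character_add]
  split_ifs with h
  · rw [h, add_neg_cancel, integral_character_zero, inv_mul_cancel₀ two_pi_sq_ne_zero]
  · rw [integral_character_of_ne fun h' => h (add_neg_eq_zero.1 h').symm, mul_zero]

theorem fourier_ext {f g : Smooth} (h : ∀ p, fourier f p = fourier g p) : f = g :=
  Smooth.ext_coeff fun p => by
    have := h (-p)
    rwa [fourier, fourier, neg_neg,
      mul_right_inj' (inv_ne_zero two_pi_sq_ne_zero)] at this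

/-- Differentiation commutes with partial Fourier sums, so each seminorm reduces to uniform
convergence for a derivative of `f`. Convergence in the Fréchet topology is what allows
distributions to be evaluated term by term. -/
theorem hasSum_fourier (f : Smooth) : HasSum (fun p => fourier f p • character p) f := by
  refine (withSeminorms.tendsto_nhds _ f).2 fun k ε hε => ?_
  have hsum : ∀ (f : Smooth) (s : Finset (ℤ × ℤ)),
      Dt (∑ p ∈ s, fourier f p • character p) = ∑ p ∈ s, fourier (Dt f) p • character p ∧
      Dx (∑ p ∈ s, fourier f p • character p) = ∑ p ∈ s, fourier (Dx f) p • character p := by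
    intro f s
    constructor <;> rw [map_sum] <;> refine Finset.sum_congr rfl fun p _ => ?_
    · rw [map_smul, Dt_character, fourier_Dt, smul_smul, mul_comm]
    · rw [map_smul, Dx_character, fourier_Dx, smul_smul, mul_comm]
  have ht : ∀ (n : ℕ) (f : Smooth) (s : Finset (ℤ × ℤ)),
      (Dt ^ n) (∑ p ∈ s, fourier f p • character p)
        = ∑ p ∈ s, fourier ((Dt ^ n) f) p • character p := by
    intro n
    induction n with
    | zero => intro f s; rfl
    | succ n ih =>
      intro f s
      rw [pow_succ, Module.End.mul_apply, Module.End.mul_apply, (hsum f s).1, ih]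
  have hx : ∀ (n : ℕ) (f : Smooth) (s : Finset (ℤ × ℤ)),
      (Dx ^ n) (∑ p ∈ s, fourier f p • character p)
        = ∑ p ∈ s, fourier ((Dx ^ n) f) p • character p := by
    intro n
    induction n with
    | zero => intro f s; rfl
    | succ n ih =>
      intro f s
      rw [pow_succ, Module.End.mul_apply, Module.End.mul_apply, (hsum f s).2, ih]
  have h := (rapidDecay_fourier ((Dt ^ k.1) ((Dx ^ k.2) f))).tendsto_supSeminorm
  filter_upwards [h.eventually (gt_mem_nhds hε)] with s hs
  rw [series_fourier, ← ht, ← hx, ← map_sub, ← map_sub] at hs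
  exact hs

theorem mean_eq_fourier_zero (f : Smooth) : f.mean = fourier f 0 := by
  rw [fourier, neg_zero, coeff, character_zero, mul_one, ← one_div]
  rfl

/-! ### Fourier coefficients of distributions -/

theorem Distribution.ext_character {u v : Distribution}
    (h : ∀ p, u (character p) = v (character p)) : u = v := by
  ext f
  have hu := (hasSum_fourier f).mapL u
  have hv := (hasSum_fourier f).mapL v
  simp only [map_smul, h] at hu hv
  exact hu.unique hv

/-- For the converse, the density is the Fourier series with these coefficients, reflected and
normalised; it agrees with `u` on characters, which determine a distribution. -/
theorem Distribution.isSmooth_iff_rapidDecay (u : Distribution) :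
    u.IsSmooth ↔ RapidDecay fun p => u (character p) := by
  rw [Distribution.isSmooth_iff]
  constructor
  · rintro ⟨g, rfl⟩
    exact rapidDecay_coeff g
  · intro h
    refine ⟨(h.comp_neg.const_mul ((2 * Real.pi) ^ 2)⁻¹).series, Distribution.ext_character
      fun p => ?_⟩
    change _ = coeff _ p
    rw [RapidDecay.coeff_series, neg_neg, mul_inv_cancel_left₀ two_pi_sq_ne_zero]

/-- Every bounded family is the family of Fourier coefficients of a distribution. -/
theorem exists_distribution {a : ℤ × ℤ → ℂ} {B : ℝ} (ha : ∀ p, ‖a p‖ ≤ B) :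
    ∃ u : Distribution, ∀ p, u (character p) = a p := by
  have hB : 0 ≤ B := (norm_nonneg _).trans (ha 0)
  have hs : ∀ f, Summable fun p => ‖a p * fourier f p‖ := fun f =>
    ((rapidDecay_fourier f).of_le (b := fun p => a p * fourier f p) (C := B) (M := 0) fun p => by
      rw [norm_mul, pow_zero, mul_one]
      gcongr
      exact ha p).summable_norm
  let U : Smooth →ₗ[ℂ] ℂ :=
    { toFun := fun f => ∑' p, a p * fourier f p
      map_add' := fun f g => by
        simp only [fourier_add, mul_add]
        exact (hs f).of_norm.tsum_add (hs g).of_norm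
      map_smul' := fun c f => by
        simp only [fourier_smul, mul_left_comm _ c, tsum_mul_left]
        rfl }
  let S := ∑' p, (weight p ^ 2)⁻¹
  have hS : 0 ≤ S := tsum_nonneg fun p => by positivity
  -- Two powers of `bessel` suffice, because the inverse square of the weight is summable.
  have hbound : ∀ f, ‖U f‖ ≤ B * S * supSeminorm ((bessel ^ 2) f) := by
    intro f
    refine (norm_tsum_le_tsum_norm (hs f)).trans ?_
    have hle : ∀ p, ‖a p * fourier f p‖
        ≤ B * supSeminorm ((bessel ^ 2) f) * (weight p ^ 2)⁻¹ := by
      intro p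
      have hw := weight_pos p
      rw [norm_mul, mul_assoc]
      refine mul_le_mul (ha p) ?_ (norm_nonneg _) hB
      rw [← div_eq_mul_inv, le_div_iff₀ (by positivity), fourier, norm_mul, norm_inv, norm_pow,
        norm_mul, Complex.norm_real, Real.norm_of_nonneg Real.pi_pos.le, Complex.norm_ofNat,
        mul_assoc, ← weight_neg, inv_mul_le_iff₀ (by positivity)]
      exact norm_coeff_mul_weight_pow_le 2 f (-p)
    refine ((hs f).tsum_le_tsum hle (summable_inv_weight_sq.mul_left _)).trans_eq ?_
    rw [tsum_mul_left]
    ring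
  have hU : Continuous U := by
    refine continuous_of_norm_le
      (q := (B * S).toNNReal • supSeminorm.comp (bessel ^ 2 : Smooth →ₗ[ℂ] Smooth))
      ((continuous_supSeminorm.comp (continuous_bessel_pow 2)).const_smul _) fun f => ?_
    refine (hbound f).trans_eq ?_
    change _ = (((B * S).toNNReal : NNReal) : ℝ) * supSeminorm ((bessel ^ 2) f)
    rw [Real.coe_toNNReal _ (mul_nonneg hB hS)]
  refine ⟨⟨U, hU⟩, fun q => ?_⟩
  change ∑' p, a p * fourier (character q) p = a q
  simp [fourier_character]

/-! ### Reduction to constant coefficients -/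

theorem perturbedField_apply (ω : ℂ) (ε : Smooth) (u : Distribution) (φ : Smooth) :
    perturbedField ω ε u φ = -u (Dt φ) + ω * -u (Dx φ) + u (ε * φ) := rfl

theorem perturbedField_character (ω c : ℂ) (u : Distribution) (p : ℤ × ℤ) :
    perturbedField ω (algebraMap ℂ Smooth c) u (character p)
      = (c - (p.1 + ω * p.2)) * u (character p) := by
  rw [perturbedField_apply, Dt_character, Dx_character, ← Algebra.smul_def]
  simp only [map_smul, smul_eq_mul]
  ring

/-- The exponential of a smooth function. -/
noncomputable def Smooth.exp (f : Smooth) : Smooth :=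
  ⟨fun z => Complex.exp (f z), f.contDiff.cexp, fun t x => congrArg Complex.exp (f.2.2.1 t x),
    fun t x => congrArg Complex.exp (f.2.2.2 t x)⟩

theorem Smooth.exp_neg_mul_exp (f : Smooth) : (-f).exp * f.exp = 1 :=
  Smooth.ext fun z => by
    change Complex.exp (-f.1 z) * Complex.exp (f.1 z) = 1
    rw [← Complex.exp_add, neg_add_cancel, Complex.exp_zero]

theorem dirD_exp (v : ℝ × ℝ) (f : Smooth) : dirD v f.exp = f.exp * dirD v f :=
  Smooth.ext fun z => by
    have h : HasFDerivAt f.exp.1 (Complex.exp (f.1 z) • fderiv ℝ f.1 z) z :=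
      (f.differentiable z).hasFDerivAt.cexp
    rw [dirD_apply, h.fderiv, Smooth.mul_apply, dirD_apply]
    change -Complex.I * (Complex.exp (f.1 z) * fderiv ℝ f.1 z v)
      = Complex.exp (f.1 z) * (-Complex.I * fderiv ℝ f.1 z v)
    ring

theorem Dt_exp (f : Smooth) : Dt f.exp = f.exp * Dt f := dirD_exp _ f

theorem Dx_exp (f : Smooth) : Dx f.exp = f.exp * Dx f := dirD_exp _ f

/-- By the Leibniz rule, moving `exp K` through the vector field creates the zero-order term `D_t K
+ ω D_x K`, which turns `ε'` into `ε`. -/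
theorem perturbedField_mul_exp {ω : ℂ} {ε ε' K : Smooth} (hK : Dt K + ω • Dx K = ε - ε')
    (u : Distribution) : perturbedField ω ε' (Distribution.mul K.exp u)
      = Distribution.mul K.exp (perturbedField ω ε u) := by
  ext φ
  have h : K.exp * (ε' * φ) = ε * (K.exp * φ) - (K.exp * Dt K) * φ - ω • (K.exp * Dx K * φ) := by
    have : ε' = ε - (Dt K + ω • Dx K) := by rw [hK, sub_sub_cancel]
    rw [this]
    simp only [Algebra.smul_def]
    ring
  simp only [perturbedField_apply, Distribution.mul_apply]
  rw [h, Dt_mul, Dx_mul, Dt_exp, Dx_exp]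
  simp only [map_add, map_sub, map_smul, smul_eq_mul]
  ring

theorem GloballyHypoelliptic.of_conj {ω : ℂ} {ε ε' K : Smooth}
    (hK : Dt K + ω • Dx K = ε - ε') (h : GloballyHypoelliptic (perturbedField ω ε')) :
    GloballyHypoelliptic (perturbedField ω ε) := by
  intro u hu
  have := (h (Distribution.mul K.exp u) (by
    rw [perturbedField_mul_exp hK]
    exact hu.mul _)).mul (-K).exp
  rwa [Distribution.mul_mul, Smooth.exp_neg_mul_exp, Distribution.one_mul] at this

theorem globallyHypoelliptic_iff_of_conj {ω : ℂ} {ε ε' K : Smooth}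
    (hK : Dt K + ω • Dx K = ε - ε') : GloballyHypoelliptic (perturbedField ω ε) ↔
      GloballyHypoelliptic (perturbedField ω ε') :=
  ⟨.of_conj (K := -K) (by
    rw [map_neg, map_neg, smul_neg, ← neg_add, hK, neg_sub]), .of_conj hK⟩

theorem fourier_algebraMap (c : ℂ) (p : ℤ × ℤ) :
    fourier (algebraMap ℂ Smooth c) p = if p = 0 then c else 0 := by
  rw [Algebra.algebraMap_eq_smul_one, fourier_smul, ← character_zero, fourier_character, mul_ite,
    mul_one, mul_zero]

/-- If the symbol `m + ω n` is bounded below by a negative power of the weight, then the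
zero-order term may be replaced by its mean. -/
theorem globallyHypoelliptic_iff_mean {ω : ℂ} (ε : Smooth) {c : ℝ} (hc : 0 < c) {M : ℕ}
    (h : ∀ p : ℤ × ℤ, p ≠ 0 → c ≤ ‖(p.1 : ℂ) + ω * p.2‖ * weight p ^ M) :
    GloballyHypoelliptic (perturbedField ω ε) ↔
      GloballyHypoelliptic (perturbedField ω (algebraMap ℂ Smooth ε.mean)) := by
  -- These are the coefficients of `K`. At `p = 0` the quotient is zero by convention, consistent
  -- with `ε - ε.mean` having no coefficient there.
  have ha : RapidDecay fun p => fourier ε p / (p.1 + ω * p.2) := by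
    refine (rapidDecay_fourier ε).of_le (C := c⁻¹) (M := M) fun p => ?_
    have hw := weight_pos p
    rcases eq_or_ne p 0 with rfl | hp
    · simp only [Prod.fst_zero, Prod.snd_zero, Int.cast_zero, mul_zero, add_zero, div_zero,
        norm_zero]
      positivity
    · have hpos : 0 < ‖(p.1 : ℂ) + ω * p.2‖ :=
        pos_of_mul_pos_left (hc.trans_le (h p hp)) (by positivity)
      rw [norm_div, div_le_iff₀ hpos, inv_mul_eq_div, div_mul_eq_mul_div, div_mul_eq_mul_div,
        le_div_iff₀ hc]
      calc ‖fourier ε p‖ * c ≤ ‖fourier ε p‖ * (‖(p.1 : ℂ) + ω * p.2‖ * weight p ^ M) := by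
            gcongr; exact h p hp
        _ = _ := by ring
  refine globallyHypoelliptic_iff_of_conj (K := ha.series) (fourier_ext fun p => ?_)
  rw [fourier_add, fourier_smul, fourier_Dt, fourier_Dx, fourier_sub, fourier_algebraMap,
    mean_eq_fourier_zero, ha.fourier_series]
  split_ifs with hp
  · simp [hp]
  · have hne : (p.1 : ℂ) + ω * p.2 ≠ 0 := fun h0 => by
      have := h p hp
      rw [h0, norm_zero, zero_mul] at this
      linarith
    field_simp
    ring

theorem globallyHypoelliptic_const {ω ε₀ : ℂ} {c : ℝ} (hc : 0 < c) {M : ℕ}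
    (h : ∀ᶠ p : ℤ × ℤ in cofinite, c ≤ ‖ε₀ - (p.1 + ω * p.2)‖ * weight p ^ M) :
    GloballyHypoelliptic (perturbedField ω (algebraMap ℂ Smooth ε₀)) := by
  intro u hu
  rw [Distribution.isSmooth_iff_rapidDecay] at hu ⊢
  refine hu.of_eventually_le (C := c⁻¹) (M := M) (h.mono fun p hp => ?_)
  rw [perturbedField_character, norm_mul, inv_mul_eq_div, div_mul_eq_mul_div, le_div_iff₀ hc]
  calc ‖u (character p)‖ * c
      ≤ ‖u (character p)‖ * (‖ε₀ - (p.1 + ω * p.2)‖ * weight p ^ M) := by gcongr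
    _ = _ := by ring

/-! ### Lower bounds for the symbol -/

theorem eventually_le_abs_add_abs (R : ℝ) :
    ∀ᶠ p : ℤ × ℤ in cofinite, R ≤ |(p.1 : ℝ)| + |(p.2 : ℝ)| := by
  refine eventually_cofinite.2 (((Set.finite_Icc (-⌈R⌉) ⌈R⌉).prod
    (Set.finite_Icc (-⌈R⌉) ⌈R⌉)).subset fun p hp => ?_)
  have hp : |(p.1 : ℝ)| + |(p.2 : ℝ)| < R := not_le.1 hp
  have hR := Int.le_ceil R
  have h1 : |(p.1 : ℝ)| ≤ ⌈R⌉ := by linarith [abs_nonneg (p.2 : ℝ)]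
  have h2 : |(p.2 : ℝ)| ≤ ⌈R⌉ := by linarith [abs_nonneg (p.1 : ℝ)]
  rw [← Int.cast_abs, Int.cast_le, abs_le] at h1 h2
  exact ⟨h1, h2⟩

/-- The imaginary part `β n` controls `n`; the real part then controls `m` up to `|α| |n|`. -/
theorem exists_abs_add_abs_le_norm_symbol {α β : ℝ} (hβ : β ≠ 0) :
    ∃ c : ℝ, 0 < c ∧ ∀ p : ℤ × ℤ, c * (|(p.1 : ℝ)| + |(p.2 : ℝ)|) ≤
      ‖(p.1 : ℂ) + ((α : ℂ) + Complex.I * β) * p.2‖ := by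
  have hβ' : 0 < |β| := abs_pos.2 hβ
  refine ⟨|β| / (1 + |α| + |β|), by positivity, fun p => ?_⟩
  set z := (p.1 : ℂ) + ((α : ℂ) + Complex.I * β) * p.2 with hz
  have him : |β| * |(p.2 : ℝ)| ≤ ‖z‖ := by
    rw [← abs_mul]
    refine le_of_eq_of_le ?_ (Complex.abs_im_le_norm z)
    simp [hz]
  have hre : |(p.1 : ℝ)| ≤ ‖z‖ + |α| * |(p.2 : ℝ)| := by
    have h1 : |(p.1 : ℝ) + α * p.2| ≤ ‖z‖ := by
      refine le_of_eq_of_le ?_ (Complex.abs_re_le_norm z)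
      simp [hz]
    have h2 := abs_sub ((p.1 : ℝ) + α * p.2) (α * p.2)
    rw [add_sub_cancel_right, abs_mul] at h2
    linarith
  rw [div_mul_eq_mul_div, div_le_iff₀ (by positivity)]
  nlinarith [mul_le_mul_of_nonneg_left hre hβ'.le, mul_le_mul_of_nonneg_left him (abs_nonneg α)]

theorem one_le_abs_add_abs {p : ℤ × ℤ} (hp : p ≠ 0) : 1 ≤ |(p.1 : ℝ)| + |(p.2 : ℝ)| := by
  rw [← Int.cast_abs, ← Int.cast_abs, ← Int.cast_add, ← Int.cast_one, Int.cast_le]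
  by_contra! h
  refine hp (Prod.ext ?_ ?_)
  · exact abs_eq_zero.1 (by linarith [abs_nonneg p.1, abs_nonneg p.2])
  · exact abs_eq_zero.1 (by linarith [abs_nonneg p.1, abs_nonneg p.2])

theorem globallyHypoelliptic_of_ne_zero {α β : ℝ} (hβ : β ≠ 0) (ε : Smooth) :
    GloballyHypoelliptic (perturbedField ((α : ℂ) + Complex.I * β) ε) := by
  obtain ⟨c, hc, h⟩ := exists_abs_add_abs_le_norm_symbol (α := α) hβ
  rw [globallyHypoelliptic_iff_mean ε hc (M := 0) fun p hp => ?_]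
  · refine globallyHypoelliptic_const one_pos (M := 0) ?_
    -- Beyond this radius the symbol exceeds `‖ε.mean‖` by at least 1.
    filter_upwards [eventually_le_abs_add_abs ((1 + ‖ε.mean‖) / c)] with p hp
    rw [div_le_iff₀ hc, mul_comm] at hp
    rw [pow_zero, mul_one, norm_sub_rev]
    linarith [h p, norm_sub_norm_le ((p.1 : ℂ) + ((α : ℂ) + Complex.I * β) * p.2) ε.mean]
  · rw [pow_zero, mul_one]
    exact le_trans (le_mul_of_one_le_right hc.le (one_le_abs_add_abs hp)) (h p)

theorem abs_le_weight (p : ℤ × ℤ) : |(p.2 : ℝ)| ≤ weight p := by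
  simpa only [Complex.norm_intCast] using norm_snd_le_weight p

theorem exists_le_norm_symbol_of_not_liouville {α : ℝ} (hirr : Irrational α)
    (hα : ¬ Liouville α) : ∃ (c : ℝ) (M : ℕ), 0 < c ∧ ∀ p : ℤ × ℤ, p ≠ 0 →
      c ≤ ‖(p.1 : ℂ) + (α : ℂ) * p.2‖ * weight p ^ M := by
  rw [Liouville] at hα
  push Not at hα
  obtain ⟨N, hN⟩ := hα
  refine ⟨(1 / 2) ^ N, N, by positivity, fun p hp => ?_⟩
  have hw := one_le_weight p
  have hnorm : ‖(p.1 : ℂ) + (α : ℂ) * p.2‖ = |(p.1 : ℝ) + α * p.2| := by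
    rw [← Real.norm_eq_abs, ← Complex.norm_real]
    push_cast
    rfl
  rw [hnorm]
  -- `Liouville` only concerns denominators greater than 1, so `a / b` is written as `2a / 2b` to
  -- include `b = 1`; this costs the factor `2 ^ N`.
  have key : ∀ a b : ℤ, 1 ≤ b → (1 / 2) ^ N ≤ |(b : ℝ) * α - a| * (b : ℝ) ^ N := by
    intro a b hb
    have hb1 : (1 : ℝ) ≤ b := by exact_mod_cast hb
    have h2 := hN (2 * a) (2 * b) (by omega) (by
      intro h
      exact hirr ⟨((2 * a : ℤ) : ℚ) / ((2 * b : ℤ) : ℚ), by rw [h]; push_cast; rfl⟩)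
    push_cast at h2
    rw [mul_div_mul_left _ _ two_ne_zero, div_le_iff₀ (by positivity), mul_pow] at h2
    have h3 : |α - a / b| ≤ |(b : ℝ) * α - a| := by
      have : (b : ℝ) * α - a = b * (α - a / b) := by field_simp
      rw [this, abs_mul, abs_of_pos (one_pos.trans_le hb1)]
      exact le_mul_of_one_le_left (abs_nonneg _) hb1
    have h4 : 1 ≤ |(b : ℝ) * α - a| * (2 ^ N * b ^ N) := h2.trans (by gcongr)
    rw [one_div, inv_pow, inv_le_iff_one_le_mul₀ (by positivity)]
    linarith
  rcases lt_trichotomy p.2 0 with h | h | h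
  · refine (key p.1 (-p.2) (by omega)).trans ?_
    have : ((-p.2 : ℤ) : ℝ) * α - p.1 = -(p.1 + α * p.2) := by push_cast; ring
    rw [this, abs_neg]
    have h0 : (0 : ℝ) ≤ (-p.2 : ℤ) := by exact_mod_cast (by omega : 0 ≤ -p.2)
    gcongr
    rw [Int.cast_neg]
    exact (neg_le_abs _).trans (abs_le_weight p)
  · have h1 := one_le_abs_add_abs hp
    rw [h, Int.cast_zero, abs_zero, add_zero] at h1
    rw [h, Int.cast_zero, mul_zero, add_zero]
    calc ((1 : ℝ) / 2) ^ N ≤ 1 := pow_le_one₀ (by norm_num) (by norm_num)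
      _ ≤ |(p.1 : ℝ)| * weight p ^ N := one_le_mul_of_one_le_of_one_le h1 (one_le_pow₀ hw)
  · refine (key (-p.1) p.2 (by omega)).trans ?_
    have : (p.2 : ℝ) * α - (-p.1 : ℤ) = p.1 + α * p.2 := by push_cast; ring
    rw [this]
    have h0 : (0 : ℝ) ≤ p.2 := by exact_mod_cast h.le
    gcongr
    exact (le_abs_self _).trans (abs_le_weight p)

/-! ### Constant coefficients and real `ω` -/

theorem globallyHypoelliptic_const_of_le_iInf {α : ℝ} {ε₀ : ℂ} {C θ : ℝ} (hC : 0 < C)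
    (hθ : 0 < θ) {ℓ₀ : ℕ} (hℓ₀ : 0 < ℓ₀) (h : ∀ ℓ : ℕ, ℓ₀ ≤ ℓ →
      C * (ℓ : ℝ) ^ (-θ) ≤ (⨅ τ : ℤ, ‖(τ : ℂ) + (α : ℂ) * (ℓ : ℂ) + ε₀‖) ∧
      C * (ℓ : ℝ) ^ (-θ) ≤ (⨅ τ : ℤ, ‖(τ : ℂ) - (α : ℂ) * (ℓ : ℂ) + ε₀‖)) :
    GloballyHypoelliptic (perturbedField α (algebraMap ℂ Smooth ε₀)) := by
  refine globallyHypoelliptic_const (c := min C 1) (M := ⌈θ⌉₊) (by positivity) ?_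
  -- If `|n| < ℓ₀`, the hypothesis says nothing, but this threshold makes `|m|` so large that the
  -- multiplier has norm at least 1.
  filter_upwards [eventually_le_abs_add_abs (ℓ₀ + |α| * ℓ₀ + ‖ε₀‖ + 1)] with p hp
  have hw := one_le_weight p
  have bdd : ∀ z : ℂ, BddBelow (Set.range fun τ : ℤ => ‖(τ : ℂ) + z‖) := fun z =>
    ⟨0, by rintro _ ⟨τ, rfl⟩; exact norm_nonneg _⟩
  have hbound : ∀ ℓ : ℕ, ℓ₀ ≤ ℓ → (ℓ : ℝ) ≤ weight p → ∀ y : ℝ,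
      C * (ℓ : ℝ) ^ (-θ) ≤ y → min C 1 ≤ y * weight p ^ ⌈θ⌉₊ := by
    intro ℓ hℓ hle y hy
    have hpos : (0 : ℝ) < ℓ := Nat.cast_pos.2 (hℓ₀.trans_le hℓ)
    rw [Real.rpow_neg hpos.le, ← div_eq_mul_inv, div_le_iff₀ (by positivity)] at hy
    have hy0 : 0 ≤ y := (pos_of_mul_pos_left (hC.trans_le hy) (by positivity)).le
    refine (min_le_left _ _).trans (hy.trans ?_)
    gcongr
    calc (ℓ : ℝ) ^ θ ≤ weight p ^ θ := by gcongr
      _ ≤ weight p ^ (⌈θ⌉₊ : ℝ) := Real.rpow_le_rpow_of_exponent_le hw (Nat.le_ceil θ)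
      _ = _ := Real.rpow_natCast _ _
  by_cases hn : ℓ₀ ≤ p.2.natAbs
  · have habs : ((p.2.natAbs : ℕ) : ℝ) ≤ weight p := by
      rw [Nat.cast_natAbs, Int.cast_abs]
      exact abs_le_weight p
    refine hbound _ hn habs _ ?_
    obtain ⟨h1, h2⟩ := h _ hn
    -- With `τ = -m` and `ℓ = |n|`, the multiplier `ε₀ - (m + α n)` is `τ - α ℓ + ε₀` for `n ≥ 0`
    -- and `τ + α ℓ + ε₀` for `n ≤ 0`.
    rcases le_total 0 p.2 with h0 | h0
    · refine h2.trans ?_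
      simp only [sub_eq_add_neg, add_assoc]
      refine (ciInf_le (bdd _) (-p.1)).trans_eq ?_
      congr 1
      rw [Nat.cast_natAbs, abs_of_nonneg h0]
      push_cast
      ring
    · refine h1.trans ?_
      simp only [add_assoc]
      refine (ciInf_le (bdd _) (-p.1)).trans_eq ?_
      congr 1
      rw [Nat.cast_natAbs, abs_of_nonpos h0]
      push_cast
      ring
  · have hn' : |(p.2 : ℝ)| ≤ ℓ₀ := by
      rw [← Int.cast_abs, ← Nat.cast_natAbs]
      exact_mod_cast (not_le.1 hn).le
    have hp1 : ‖(p.1 : ℂ)‖ = |(p.1 : ℝ)| := Complex.norm_intCast _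
    have hp2 : ‖(α : ℂ) * p.2‖ = |α| * |(p.2 : ℝ)| := by
      rw [norm_mul, Complex.norm_intCast, Complex.norm_real, Real.norm_eq_abs]
    have htri : ‖(p.1 : ℂ)‖ ≤ ‖ε₀‖ + ‖(α : ℂ) * p.2‖ + ‖ε₀ - (p.1 + α * p.2)‖ := by
      have : (p.1 : ℂ) = ε₀ - α * p.2 - (ε₀ - (p.1 + α * p.2)) := by ring
      rw [congrArg norm this]
      exact (norm_sub_le _ _).trans (by gcongr; exact norm_sub_le _ _)
    have := mul_le_mul_of_nonneg_left hn' (abs_nonneg α)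
    refine (min_le_right _ _).trans
      (one_le_mul_of_one_le_of_one_le ?_ (one_le_pow₀ hw))
    linarith

/-- The indicator of the range of `P` is bounded, hence comes from a distribution, but does not
decay; multiplied by the symbol, it decays rapidly. -/
theorem not_globallyHypoelliptic_const {α : ℝ} {ε₀ : ℂ} {P : ℕ → ℤ × ℤ}
    (h1 : ∀ k : ℕ, (k : ℝ) + 1 ≤ |((P k).2 : ℝ)|)
    (h2 : ∀ k : ℕ, ‖ε₀ - ((P k).1 + α * (P k).2)‖ * |((P k).2 : ℝ)| ^ (k + 1) ≤ 1) :
    ¬ GloballyHypoelliptic (perturbedField α (algebraMap ℂ Smooth ε₀)) := by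
  classical
  intro h
  obtain ⟨u, hu⟩ := exists_distribution (a := fun p => if p ∈ Set.range P then 1 else 0) (B := 1)
    fun p => by split_ifs <;> simp
  have hsmooth : u.IsSmooth := by
    refine h u ((Distribution.isSmooth_iff_rapidDecay _).2 (rapidDecay_of_eventually fun N => ?_))
    set A := 2 + ‖ε₀‖ + |α|
    refine ⟨(2 + A ^ 2) ^ N, ?_⟩
    -- Dropping these points leaves `k ≥ 2N`, so that `h2` absorbs the `n ^ (2 * N)` coming from
    -- `weight ^ N`.
    have hfin : (P '' Set.Iio (2 * N)).Finite := (Set.finite_Iio _).image P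
    filter_upwards [hfin.compl_mem_cofinite] with p hp
    rw [perturbedField_character, hu]
    split_ifs with hS
    swap
    · rw [mul_zero, norm_zero, zero_mul]; positivity
    obtain ⟨k, rfl⟩ := hS
    have hk : 2 * N ≤ k := not_lt.1 fun hk => hp ⟨k, hk, rfl⟩
    set s := ‖ε₀ - ((P k).1 + α * (P k).2)‖
    set n := |((P k).2 : ℝ)| with hn
    have hn1 : 1 ≤ n := le_trans (by linarith [k.cast_nonneg (α := ℝ)]) (h1 k)
    have hs1 : s ≤ 1 :=
      le_trans (le_mul_of_one_le_right (norm_nonneg _) (one_le_pow₀ hn1)) (h2 k)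
    -- A multiplier of norm at most 1 forces `m` to be comparable to `α n`, so the weight is at most
    -- a constant times `n²`.
    have hm : |((P k).1 : ℝ)| ≤ A * n := by
      have hp2 : ‖(α : ℂ) * (P k).2‖ = |α| * n := by
        rw [norm_mul, Complex.norm_intCast, Complex.norm_real, Real.norm_eq_abs]
      have htri : ‖((P k).1 : ℂ)‖ ≤ ‖ε₀‖ + ‖(α : ℂ) * (P k).2‖ + s := by
        have : ((P k).1 : ℂ) = ε₀ - α * (P k).2 - (ε₀ - ((P k).1 + α * (P k).2)) := by ring
        rw [congrArg norm this]
        exact (norm_sub_le _ _).trans (by gcongr; exact norm_sub_le _ _)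
      rw [hp2, Complex.norm_intCast] at htri
      have := mul_le_mul_of_nonneg_left hn1 (norm_nonneg ε₀)
      have hA : A * n = 2 * n + ‖ε₀‖ * n + |α| * n := by ring
      linarith
    have hweight : weight (P k) ≤ (2 + A ^ 2) * n ^ 2 := by
      have hm2 : ((P k).1 : ℝ) ^ 2 ≤ (A * n) ^ 2 := by
        rw [← sq_abs]
        gcongr
      rw [weight, ← sq_abs ((P k).2 : ℝ)]
      nlinarith
    rw [mul_one]
    calc s * weight (P k) ^ N ≤ s * ((2 + A ^ 2) * n ^ 2) ^ N := by
          have := weight_pos (P k)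
          gcongr
      _ = (2 + A ^ 2) ^ N * (s * n ^ (2 * N)) := by rw [mul_pow, ← pow_mul]; ring
      _ ≤ (2 + A ^ 2) ^ N * (s * n ^ (k + 1)) := by
          gcongr
          omega
      _ ≤ (2 + A ^ 2) ^ N * 1 := by gcongr; exact h2 k
      _ = _ := mul_one _
  obtain ⟨C, hC⟩ := (Distribution.isSmooth_iff_rapidDecay u).1 hsmooth 1
  obtain ⟨k, hk⟩ := exists_nat_gt C
  have := hC (P k)
  simp only at this
  rw [hu, if_pos (Set.mem_range_self k), norm_one, one_mul, pow_one] at this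
  linarith [abs_le_weight (P k), h1 k]

theorem exists_le_iInf_of_globallyHypoelliptic {α : ℝ} {ε₀ : ℂ}
    (h : GloballyHypoelliptic (perturbedField α (algebraMap ℂ Smooth ε₀))) :
    ∃ C θ : ℝ, 0 < C ∧ 0 < θ ∧ ∃ ℓ₀ : ℕ, 0 < ℓ₀ ∧ ∀ ℓ : ℕ, ℓ₀ ≤ ℓ →
      C * (ℓ : ℝ) ^ (-θ) ≤ (⨅ τ : ℤ, ‖(τ : ℂ) + (α : ℂ) * (ℓ : ℂ) + ε₀‖) ∧
      C * (ℓ : ℝ) ^ (-θ) ≤ (⨅ τ : ℤ, ‖(τ : ℂ) - (α : ℂ) * (ℓ : ℂ) + ε₀‖) := by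
  by_contra hcon
  -- If no such `p` existed for some `k`, the desired bound would hold with `C = 1` and `θ = ℓ₀ = k
  -- + 1`.
  have key : ∀ k : ℕ, ∃ p : ℤ × ℤ, (k : ℝ) + 1 ≤ |(p.2 : ℝ)| ∧
      ‖ε₀ - (p.1 + α * p.2)‖ * |(p.2 : ℝ)| ^ (k + 1) ≤ 1 := by
    intro k
    by_contra! hk
    have hlow : ∀ ℓ : ℕ, k + 1 ≤ ℓ → ∀ p : ℤ × ℤ, |(p.2 : ℝ)| = ℓ →
        1 * (ℓ : ℝ) ^ (-((k + 1 : ℕ) : ℝ)) ≤ ‖ε₀ - (p.1 + α * p.2)‖ := by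
      intro ℓ hℓ p hp
      have hℓ' : (k : ℝ) + 1 ≤ ℓ := by exact_mod_cast hℓ
      have hpos : (0 : ℝ) < ℓ := k.cast_add_one_pos.trans_le hℓ'
      have := hk p (by rwa [hp])
      rw [hp] at this
      rw [Real.rpow_neg hpos.le, Real.rpow_natCast, ← div_eq_mul_inv, div_le_iff₀ (by positivity)]
      exact this.le
    refine hcon ⟨1, (k + 1 : ℕ), one_pos, by positivity, k + 1, k.succ_pos, fun ℓ hℓ =>
      ⟨le_ciInf fun τ => ?_, le_ciInf fun τ => ?_⟩⟩
    · refine (hlow ℓ hℓ (-τ, -ℓ) (by simp)).trans_eq (congrArg norm ?_)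
      push_cast
      ring
    · refine (hlow ℓ hℓ (-τ, ℓ) (by simp)).trans_eq (congrArg norm ?_)
      push_cast
      ring
  choose P h1 h2 using key
  exact not_globallyHypoelliptic_const h1 h2 h

end FourierAnalysis

end Torus

theorem mainTheorem6 (α β : ℝ) (ω : ℂ) (hω : ω = (α : ℂ) + Complex.I * (β : ℂ))
    (ε : Torus.Smooth) (ε₀ : ℂ) (hε₀ : ε₀ = ε.mean) :
    (β ≠ 0 → Torus.GloballyHypoelliptic (Torus.perturbedField ω ε)) ∧
    (β = 0 → Irrational α → ¬ Liouville α →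
      List.TFAE [
        Torus.GloballyHypoelliptic (Torus.perturbedField ω ε),
        Torus.GloballyHypoelliptic (Torus.perturbedField ω (algebraMap ℂ Torus.Smooth ε₀)),
        ∃ C θ : ℝ, 0 < C ∧ 0 < θ ∧ ∃ ℓ₀ : ℕ, 0 < ℓ₀ ∧ ∀ ℓ : ℕ, ℓ₀ ≤ ℓ →
          C * (ℓ : ℝ) ^ (-θ) ≤ (⨅ τ : ℤ, ‖(τ : ℂ) + (α : ℂ) * (ℓ : ℂ) + ε₀‖) ∧
          C * (ℓ : ℝ) ^ (-θ) ≤ (⨅ τ : ℤ, ‖(τ : ℂ) - (α : ℂ) * (ℓ : ℂ) + ε₀‖)]) := by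
  subst hω hε₀
  refine ⟨fun hβ => Torus.globallyHypoelliptic_of_ne_zero hβ ε, fun hβ hirr hα => ?_⟩
  subst hβ
  rw [Complex.ofReal_zero, mul_zero, add_zero]
  obtain ⟨c, M, hc, h⟩ := Torus.exists_le_norm_symbol_of_not_liouville hirr hα
  tfae_have 1 ↔ 2 := Torus.globallyHypoelliptic_iff_mean ε hc h
  tfae_have 2 → 3 := Torus.exists_le_iInf_of_globallyHypoelliptic
  tfae_have 3 → 2 := by
    rintro ⟨C, θ, hC, hθ, ℓ₀, hℓ₀, h⟩
    exact Torus.globallyHypoelliptic_const_of_le_iInf hC hθ hℓ₀ h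
  tfae_finish
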